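/- Let $p>3$ be a prime. Let $\mathbb Z_p$ denote the ring of rational numbers whose denominator is not divisible by $p$; for $x,y\in\mathbb Z_p$ and $n\ge 1$, $x\equiv y\pmod{p^n}$ means $x-y\in p^n\mathbb Z_p$. For $a\in\mathbb Z_p$ let $\langle a\rangle_p\in\{0,1,\dots,p-1\}$ be given by $a\equiv\langle a\rangle_p\pmod p$, and let $\binom ak=\frac{a(a-1)\cdots(a-k+1)}{k!}$ with $\binom a0=1$. Define the Euler numbers by $E_0=1$, $E_n=-\sum_{k=1}^{\lfloor n/2\rfloor}\binom n{2k}E_{n-2k}$ $(n\ge 1)$ and the Euler polynomials by $E_n(x)=\frac1{2^n}\sum_{r=0}^n\binom nr(2x-1)^{n-r}E_r$ $(n\ge 0)$. **Theorem.** Let $p>3$ be a prime, let $a\in\mathbb Z_p$ with $a\not\equiv 0\pmod p$, and put $t=(a-\langle a\rangle_p)/p$. Then, modulo $p^2$ in $\mathbb Z_p$ (both sides of each congruence lie in $\mathbb Z_p$), $$\sum_{k=0}^{(p-1)/2}\binom ak\binom{-1-a}k\equiv\begin{cases}\displaystyle\sum_{k=0}^{p-1}\binom ak(-2)^k & \text{if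 }\langle a\rangle_p\le\frac{p-1}2,\\[2mm] \displaystyle\Big(1+\frac1t\Big)\sum_{k=0}^{p-1}\binom ak(-2)^k-(-1)^{\langle a\rangle_p}\frac1t & \text{if }\langle a\rangle_p>\frac{p-1}2\text{ and }t\not\equiv 0\pmod p,\\[2mm] (-1)^{\langle a\rangle_p}-pE_{p-2}(-a) & \text{if }\langle a\rangle_p>\frac{p-1}2\text{ and }t\equiv 0\pmod p.\end{cases}$$ -/

import Mathlib

/-- A rational number is `p`-integral, i.e. lies in the ring `ℤ_p` of rational numbers whose
denominator is not divisible by `p`. -/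
def IsPIntegral (p : ℕ) (x : ℚ) : Prop :=
  ¬ p ∣ x.den

/-- The congruence `x ≡ y (mod p ^ n)` in the ring of `p`-integral rational numbers: both sides are
`p`-integral and their difference is `p ^ n` times a `p`-integral number. -/
def PCongr (p n : ℕ) (x y : ℚ) : Prop :=
  IsPIntegral p x ∧ IsPIntegral p y ∧ ∃ z : ℚ, IsPIntegral p z ∧ x - y = (p : ℚ) ^ n * z

/-- The least nonnegative residue `⟨a⟩_p ∈ {0, 1, …, p - 1}` of a `p`-integral rational number `a`
modulo `p`. -/
def leastResidue (p : ℕ) (a : ℚ) : ℕ :=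
  ((a.num : ZMod p) * (a.den : ZMod p)⁻¹).val

theorem leastResidue_lt (p : ℕ) (hp : p.Prime) (a : ℚ) : leastResidue p a < p := by
  have : NeZero p := ⟨hp.ne_zero⟩
  exact ZMod.val_lt _

theorem isPIntegral_intCast (p : ℕ) (hp : p.Prime) (m : ℤ) : IsPIntegral p (m : ℚ) := by
  simpa [IsPIntegral] using hp.one_lt.ne'

/-- The residue is characterized by `a ≡ ⟨a⟩_p (mod p)`. -/
theorem pCongr_leastResidue (p : ℕ) (hp : p.Prime) (a : ℚ) (ha : IsPIntegral p a) :
    PCongr p 1 a (leastResidue p a) := by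
  have : Fact p.Prime := ⟨hp⟩
  have hden : (a.den : ZMod p) ≠ 0 := fun h => ha ((ZMod.natCast_eq_zero_iff _ _).1 h)
  have hdvd : (p : ℤ) ∣ a.num - leastResidue p a * a.den := by
    rw [← ZMod.intCast_zmod_eq_zero_iff_dvd]
    push_cast
    rw [leastResidue, ZMod.natCast_zmod_val, mul_assoc, inv_mul_cancel₀ hden]
    ring
  obtain ⟨c, hc⟩ := hdvd
  refine ⟨ha, ?_, (c : ℚ) / (a.den : ℚ), ?_, ?_⟩
  · exact_mod_cast isPIntegral_intCast p hp (leastResidue p a : ℤ)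
  · intro h
    have h2 : (((c : ℚ) / ((a.den : ℤ) : ℚ)).den : ℤ) ∣ (a.den : ℤ) := by
      rw [← Rat.divInt_eq_div]
      exact Rat.den_dvd c a.den
    exact ha (h.trans (by exact_mod_cast h2))
  · have h0 : (a.den : ℚ) ≠ 0 := by exact_mod_cast a.den_nz
    have h1 : (a.num : ℚ) - leastResidue p a * a.den = p * c := by exact_mod_cast hc
    have h2 : a * a.den = a.num := Rat.mul_den_eq_num a
    field_simp
    linarith

/-- The Euler numbers: `E_0 = 1` and `E_n = -∑_{k=1}^{⌊n/2⌋} C(n, 2k) E_{n-2k}` for `n ≥ 1`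
(the summation index below is shifted by one). -/
def eulerNum : ℕ → ℤ
  | 0 => 1
  | n + 1 => -∑ k : Fin ((n + 1) / 2),
      ((n + 1).choose (2 * ((k : ℕ) + 1)) : ℤ) * eulerNum (n + 1 - 2 * ((k : ℕ) + 1))
  decreasing_by omega

/-- The Euler polynomials `E_n(x) = 2⁻ⁿ ∑_{r=0}^n C(n, r) (2x - 1)^{n-r} E_r`. -/
def eulerPoly (n : ℕ) (x : ℚ) : ℚ :=
  1 / 2 ^ n * ∑ r ∈ Finset.range (n + 1), (n.choose r : ℚ) * (2 * x - 1) ^ (n - r) * eulerNum r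

/-! Write `p = 2n + 1`, `r = ⟨a⟩_p`, `a = r + pt`, `T = binomTwoSum (2n)`, `S = binomPairSum n`.
Both are polynomials with `p`-integral coefficients, so modulo `p²` only their values and
derivatives `τ`, `σ` at `r` matter, the derivatives modulo `p`. Pascal's rule gives closed forms for
`T(x+1) + T(x)` and `S(x+1) + S(x)`. These vanish at small integers, so both sums equal `(-1)^r`
there. At `x = r + p` they are congruent to `2p/(r+1)` modulo `p²`, so `τ` and `σ` satisfy the same
recurrence `f(r+1) + f(r) ≡ 2/(r+1)`.

Both derivatives vanish modulo `p` at `n`: `σ` because `S(-1-x) = S(x)`, and `τ` because `τ(r) +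
τ(p-1-r) ≡ 0`, which follows from `T(p) = T(-1)`. Hence `σ ≡ τ` on `0, …, n`, the first case. For `r
> n`, reflecting `a` to `-1-a` gives `S(a) ≡ (-1)^r + p(1+t)τ(r)`. Eliminating `τ(r)` through `T(a)
≡ (-1)^r + ptτ(r)` needs `t` invertible; otherwise `τ(r) ≡ -E_{p-2}(-r)`, which has the same
recurrence and the same zero at `n`. -/

open Finset in
theorem factorial_mul_ringChoose (a : ℚ) (k : ℕ) :
    (k.factorial : ℚ) * Ring.choose a k = ∏ j ∈ range k, (a - j) := by
  rw [Ring.choose_eq_smul, smul_eq_mul, mul_inv_cancel_left₀ (by exact_mod_cast k.factorial_ne_zero)]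
  rw [← Polynomial.aeval_eq_smeval, ← Polynomial.eval_map_algebraMap, descPochhammer_map,
    descPochhammer_eval_eq_prod_range]

open Finset in
theorem succ_mul_ringChoose_succ (a : ℚ) (k : ℕ) :
    ((k : ℚ) + 1) * Ring.choose a (k + 1) = (a - k) * Ring.choose a k := by
  have h1 := factorial_mul_ringChoose a (k + 1)
  have h0 := factorial_mul_ringChoose a k
  rw [prod_range_succ, ← h0, Nat.factorial_succ] at h1
  have : (k.factorial : ℚ) ≠ 0 := by exact_mod_cast k.factorial_ne_zero
  push_cast at h1
  apply mul_left_cancel₀ this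
  linear_combination h1

theorem succ_mul_ringChoose_add_one (a : ℚ) (k : ℕ) :
    ((k : ℚ) + 1) * Ring.choose (a + 1) (k + 1) = (a + 1) * Ring.choose a k := by
  rw [Ring.choose_succ_succ, mul_add, succ_mul_ringChoose_succ]
  ring

theorem ringChoose_natCast_of_lt {r k : ℕ} (h : r < k) : Ring.choose (r : ℚ) k = 0 := by
  rw [Ring.choose_natCast, Nat.choose_eq_zero_of_lt h, Nat.cast_zero]

/-- The sum `∑_{k ≤ n} C(a, k) (-2)^k`. -/
noncomputable def binomTwoSum (n : ℕ) (a : ℚ) : ℚ :=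
  ∑ k ∈ Finset.range (n + 1), Ring.choose a k * (-2) ^ k

/-- The sum `∑_{k ≤ n} C(a, k) C(-1 - a, k)`. -/
noncomputable def binomPairSum (n : ℕ) (a : ℚ) : ℚ :=
  ∑ k ∈ Finset.range (n + 1), Ring.choose a k * Ring.choose (-1 - a) k

/-- By Pascal's rule the part of each new term containing `C(a, n)` cancels the previous right-hand
side. -/
theorem binomTwoSum_add_one (n : ℕ) (a : ℚ) :
    binomTwoSum n (a + 1) + binomTwoSum n a = 2 * (-2) ^ n * Ring.choose a n := by
  induction n with
  | zero => simp [binomTwoSum]; norm_num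
  | succ n ih =>
    unfold binomTwoSum at *
    rw [Finset.sum_range_succ, Finset.sum_range_succ _ (n + 1), Ring.choose_succ_succ]
    linear_combination ih

theorem binomPairSum_add_one (n : ℕ) (a : ℚ) :
    binomPairSum n (a + 1) + binomPairSum n a
      = 2 * (Ring.choose a n * Ring.choose (-2 - a) n) := by
  induction n with
  | zero => simp [binomPairSum]; norm_num
  | succ n ih =>
    unfold binomPairSum at *
    rw [Finset.sum_range_succ, Finset.sum_range_succ _ (n + 1)]
    have h1 := succ_mul_ringChoose_succ a n
    have h2 := succ_mul_ringChoose_add_one a n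
    have h3 := succ_mul_ringChoose_succ (-2 - a) n
    have h4 := succ_mul_ringChoose_add_one (-2 - a) n
    rw [show -2 - a + 1 = -1 - a by ring] at h4
    rw [show -1 - (a + 1) = -2 - a by ring] at *
    set x := Ring.choose a n
    set y := Ring.choose (-2 - a) n
    have hn : ((n : ℚ) + 1) ≠ 0 := by positivity
    have e1 : Ring.choose a (n + 1) = (a - n) * x / (n + 1) := by
      rw [eq_div_iff hn, ← h1]; ring
    have e2 : Ring.choose (a + 1) (n + 1) = (a + 1) * x / (n + 1) := by
      rw [eq_div_iff hn, ← h2]; ring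
    have e3 : Ring.choose (-2 - a) (n + 1) = (-2 - a - n) * y / (n + 1) := by
      rw [eq_div_iff hn, ← h3]; ring
    have e4 : Ring.choose (-1 - a) (n + 1) = (-1 - a) * y / (n + 1) := by
      rw [eq_div_iff hn, ← h4]; ring
    rw [e1, e2, e3, e4]
    have : 2 * (x * y) + (a + 1) * x / (n + 1) * ((-2 - a - n) * y / (n + 1))
        + (a - n) * x / (n + 1) * ((-1 - a) * y / (n + 1))
        = 2 * ((a - n) * x / (n + 1) * ((-2 - a - n) * y / (n + 1))) := by
      field_simp
      ring
    linear_combination ih + this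

theorem binomPairSum_symm (n : ℕ) (a : ℚ) : binomPairSum n (-1 - a) = binomPairSum n a := by
  unfold binomPairSum
  refine Finset.sum_congr rfl fun k _ => ?_
  rw [show -1 - (-1 - a) = a by ring, mul_comm]

theorem binomTwoSum_zero (n : ℕ) : binomTwoSum n 0 = 1 := by
  simp [binomTwoSum, Finset.sum_range_succ', Ring.choose_zero_succ]

/-- `C(r, n)` vanishes for `r < n`, so the sum changes sign at each step from its value 1 at 0. -/
theorem binomTwoSum_natCast {n r : ℕ} (h : r ≤ n) : binomTwoSum n r = (-1) ^ r := by
  induction r with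
  | zero => simpa using binomTwoSum_zero n
  | succ r ih =>
    have := binomTwoSum_add_one n r
    rw [ringChoose_natCast_of_lt h, ih (by lia)] at this
    push_cast
    linear_combination this

theorem binomPairSum_natCast {n r : ℕ} (h : r ≤ n) : binomPairSum n r = (-1) ^ r := by
  induction r with
  | zero => simp [binomPairSum, Finset.sum_range_succ', Ring.choose_zero_succ]
  | succ r ih =>
    have := binomPairSum_add_one n r
    rw [ringChoose_natCast_of_lt h, ih (by lia)] at this
    push_cast
    linear_combination this

theorem ringChoose_neg_one (k : ℕ) : Ring.choose (-1 : ℚ) k = (-1) ^ k := by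
  induction k with
  | zero => simp
  | succ k ih =>
    have h := Ring.choose_succ_succ (-1 : ℚ) k
    rw [neg_add_cancel, Ring.choose_zero_succ, ih] at h
    linear_combination -h

theorem binomTwoSum_neg_one (n : ℕ) : binomTwoSum n (-1) = 2 * 2 ^ n - 1 := by
  have h := binomTwoSum_add_one n (-1)
  rw [neg_add_cancel, binomTwoSum_zero, ringChoose_neg_one, mul_assoc, ← mul_pow] at h
  norm_num at h
  linear_combination h

theorem binomTwoSum_natCast_add_one (n : ℕ) :
    binomTwoSum n (n + 1) = 2 * (-2) ^ n - (-1) ^ n := by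
  have h := binomTwoSum_add_one n n
  rw [binomTwoSum_natCast le_rfl, Ring.choose_natCast, Nat.choose_self] at h
  push_cast at h
  linear_combination h

/-! ### Falling factorials -/

/-- The falling factorial `x (x - 1) ⋯ (x - N + 1)`. -/
def fallingProd (N : ℕ) (x : ℚ) : ℚ := ∏ j ∈ Finset.range N, (x - j)

theorem fallingProd_natCast_self (N : ℕ) : fallingProd N N = N.factorial := by
  have := factorial_mul_ringChoose N N
  rw [Ring.choose_natCast, Nat.choose_self] at this
  simpa [fallingProd] using this.symm

theorem fallingProd_add_one_left (N : ℕ) (x : ℚ) :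
    fallingProd (N + 1) (x + 1) = (x + 1) * fallingProd N x := by
  unfold fallingProd
  rw [Finset.prod_range_succ', mul_comm]
  simp

theorem fallingProd_succ (N : ℕ) (x : ℚ) :
    fallingProd (N + 1) x = fallingProd N x * (x - N) :=
  Finset.prod_range_succ _ _

theorem fallingProd_add (m n : ℕ) (x : ℚ) :
    fallingProd (m + n) x = fallingProd m x * fallingProd n (x - m) := by
  unfold fallingProd
  rw [Finset.prod_range_add]
  congr 1
  refine Finset.prod_congr rfl fun j _ => ?_
  push_cast
  ring

theorem fallingProd_neg (n : ℕ) (x : ℚ) :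
    fallingProd n (-x) = (-1) ^ n * fallingProd n (x + n - 1) := by
  induction n with
  | zero => simp [fallingProd]
  | succ n ih =>
    have h := fallingProd_add_one_left n (x + n - 1)
    rw [fallingProd_succ, ih]
    rw [show x + n - 1 + 1 = x + (n + 1 : ℕ) - 1 by push_cast; ring] at h
    rw [h]
    push_cast
    ring

/-- The `2n + 1` factors are centred at `a + 1`: the lower `n` give `C(a, n)`, the upper `n`, after
a sign change, `C(-2 - a, n)`. -/
theorem fallingProd_two_mul_add_one (n : ℕ) (a : ℚ) :
    fallingProd (2 * n + 1) (a + 1 + n) = (-1) ^ n * n.factorial ^ 2 * (a + 1)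
      * (Ring.choose a n * Ring.choose (-2 - a) n) := by
  have h1 := factorial_mul_ringChoose a n
  have h2 := factorial_mul_ringChoose (-2 - a) n
  change _ = fallingProd n _ at h1 h2
  have h3 := fallingProd_add (n + 1) n (a + 1 + n)
  rw [fallingProd_succ, show a + 1 + n - (n + 1 : ℕ) = a by push_cast; ring, ← h1] at h3
  have h4 := fallingProd_neg n (a + 2)
  rw [show -(a + 2) = -2 - a by ring, ← h2, show a + 2 + n - 1 = a + 1 + n by ring] at h4
  have h5 : ((-1 : ℚ) ^ n) * (-1) ^ n = 1 := by rw [← mul_pow]; simp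
  rw [show 2 * n + 1 = n + 1 + n by ring, h3]
  linear_combination (-(a + 1) * (n.factorial * Ring.choose a n) * (-1) ^ n) * h4
    - (a + 1) * (n.factorial * Ring.choose a n) * fallingProd n (a + 1 + n) * h5

/-! ### Euler numbers and polynomials -/

section EulerPolynomials

open Polynomial

theorem sum_range_mul_one_add_neg_one_pow (f : ℕ → ℚ) (n : ℕ) :
    ∑ j ∈ Finset.range (n + 1), f j * (1 + (-1) ^ j)
      = 2 * ∑ k ∈ Finset.range (n / 2 + 1), f (2 * k) := by
  induction n with
  | zero => simp; ring
  | succ n ih =>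
    rw [Finset.sum_range_succ, ih]
    rcases Nat.even_or_odd' n with ⟨m, rfl | rfl⟩
    · rw [show (2 * m + 1) / 2 = m by lia, show 2 * m / 2 = m by lia, pow_succ, pow_mul]
      simp
    · rw [show (2 * m + 1 + 1) / 2 = m + 1 by lia, show (2 * m + 1) / 2 = m by lia,
        Finset.sum_range_succ _ (m + 1), show 2 * m + 1 + 1 = 2 * (m + 1) by ring, pow_mul]
      simp
      ring

theorem eulerNum_zero : eulerNum 0 = 1 := by rw [eulerNum]

theorem eulerNum_succ (n : ℕ) : eulerNum (n + 1) = -∑ k ∈ Finset.range ((n + 1) / 2),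
    ((n + 1).choose (2 * (k + 1)) : ℤ) * eulerNum (n + 1 - 2 * (k + 1)) := by
  rw [eulerNum, Finset.sum_range]

theorem eulerNum_odd (m : ℕ) : eulerNum (2 * m + 1) = 0 := by
  induction m using Nat.strong_induction_on with
  | _ m ih =>
    rw [eulerNum_succ, neg_eq_zero]
    refine Finset.sum_eq_zero fun k hk => ?_
    rw [Finset.mem_range] at hk
    rw [show 2 * m + 1 - 2 * (k + 1) = 2 * (m - (k + 1)) + 1 by lia, ih _ (by lia), mul_zero]

/-- The defining recurrence in umbral form, `(E + 1)^n + (E - 1)^n = 2·0^n`; the factor `1 + (-1)^j`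
selects even indices. -/
theorem sum_choose_mul_eulerNum (n : ℕ) :
    ∑ j ∈ Finset.range (n + 1), (n.choose j : ℚ) * eulerNum (n - j) * (1 + (-1) ^ j)
      = if n = 0 then 2 else 0 := by
  rw [sum_range_mul_one_add_neg_one_pow fun j => (n.choose j : ℚ) * eulerNum (n - j)]
  cases n with
  | zero => simp [eulerNum_zero]
  | succ n =>
    have h := eulerNum_succ n
    rw [Finset.sum_range_succ']
    have h' : (eulerNum (n + 1) : ℚ) = -∑ k ∈ Finset.range ((n + 1) / 2),
      ((n + 1).choose (2 * (k + 1)) : ℚ) * eulerNum (n + 1 - 2 * (k + 1)) := by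
      rw [h]; push_cast; rfl
    simp [h']

/-- The linear functional on polynomials that sends `X ^ n` to the Euler number `E_n`. -/
noncomputable def eulerFunctional : ℚ[X] →ₗ[ℚ] ℚ :=
  (basisMonomials ℚ).constr ℚ fun n => (eulerNum n : ℚ)

theorem eulerFunctional_X_pow (n : ℕ) : eulerFunctional (X ^ n) = eulerNum n := by
  have := (basisMonomials ℚ).constr_basis ℚ (fun n => (eulerNum n : ℚ)) n
  simp only [coe_basisMonomials] at this
  rwa [← X_pow_eq_monomial] at this

theorem eulerFunctional_X_add_C_pow (n : ℕ) (y : ℚ) :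
    eulerFunctional ((X + C y) ^ n)
      = ∑ r ∈ Finset.range (n + 1), (n.choose r : ℚ) * y ^ (n - r) * eulerNum r := by
  rw [add_pow, map_sum]
  refine Finset.sum_congr rfl fun r _ => ?_
  rw [← eulerFunctional_X_pow, ← smul_eq_mul ((n.choose r : ℚ) * _), ← map_smul, smul_eq_C_mul, C_mul, C_pow,
    map_natCast]
  congr 1
  ring

theorem eulerFunctional_X_add_one_pow (n : ℕ) :
    eulerFunctional ((X + C 1) ^ n + (X + C (-1)) ^ n) = if n = 0 then 2 else 0 := by
  rw [map_add, eulerFunctional_X_add_C_pow, eulerFunctional_X_add_C_pow, ← Finset.sum_add_distrib,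
    ← sum_choose_mul_eulerNum, ← Finset.sum_range_reflect]
  refine Finset.sum_congr rfl fun j hj => ?_
  rw [Finset.mem_range] at hj
  rw [show n + 1 - 1 - j = n - j by lia, Nat.choose_symm (by lia), show n - (n - j) = j by lia]
  ring

theorem eulerFunctional_shift (n : ℕ) (y : ℚ) :
    eulerFunctional ((X + C (y + 1)) ^ n + (X + C (y - 1)) ^ n) = 2 * y ^ n := by
  have h : ((X + C (y + 1)) ^ n + (X + C (y - 1)) ^ n : ℚ[X])
      = ∑ r ∈ Finset.range (n + 1), ((n.choose r : ℚ) * y ^ (n - r)) •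
        ((X + C 1) ^ r + (X + C (-1)) ^ r) := by
    rw [show (X + C (y + 1) : ℚ[X]) = (X + C 1) + C y by rw [C_add]; ring,
      show (X + C (y - 1) : ℚ[X]) = (X + C (-1)) + C y by rw [C_sub, C_neg]; ring, add_pow, add_pow,
      ← Finset.sum_add_distrib]
    refine Finset.sum_congr rfl fun r _ => ?_
    rw [smul_eq_C_mul, C_mul, C_pow, map_natCast]
    ring
  rw [h, map_sum]
  simp_rw [map_smul, eulerFunctional_X_add_one_pow]
  rw [Finset.sum_range_succ']
  simp
  ring

theorem eulerPoly_eq (n : ℕ) (x : ℚ) :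
    eulerPoly n x = 1 / 2 ^ n * eulerFunctional ((X + C (2 * x - 1)) ^ n) := by
  rw [eulerFunctional_X_add_C_pow, eulerPoly]

theorem eulerPoly_add_one (n : ℕ) (x : ℚ) :
    eulerPoly n (x + 1) + eulerPoly n x = 2 * x ^ n := by
  have h := eulerFunctional_shift n (2 * x)
  rw [map_add] at h
  rw [eulerPoly_eq, eulerPoly_eq, show 2 * (x + 1) - 1 = 2 * x + 1 by ring, ← mul_add, h, mul_pow]
  field_simp

end EulerPolynomials

/-! ### `p`-integral rationals and first-order expansion modulo `p²` -/

section Integral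

variable (p : ℕ) [hp : Fact p.Prime]

/-- The subring of `p`-integral rational numbers. -/
def pInt : Subring ℚ where
  carrier := {x | IsPIntegral p x}
  one_mem' := by simpa [IsPIntegral] using hp.out.one_lt.ne'
  zero_mem' := by simpa [IsPIntegral] using hp.out.one_lt.ne'
  neg_mem' {x} hx := by simpa [IsPIntegral] using hx
  mul_mem' {x y} hx hy h :=
    ((hp.out.dvd_mul).1 (h.trans (Rat.mul_den_dvd x y))).elim hx hy
  add_mem' {x y} hx hy h :=
    ((hp.out.dvd_mul).1 (h.trans (Rat.add_den_dvd x y))).elim hx hy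

/-- The rational numbers divisible by `p ^ n` in the ring of `p`-integral rational numbers. -/
def pPow (n : ℕ) : AddSubgroup ℚ where
  carrier := {x | ∃ z ∈ pInt p, x = p ^ n * z}
  zero_mem' := ⟨0, zero_mem _, by simp⟩
  add_mem' := by
    rintro _ _ ⟨x, hx, rfl⟩ ⟨y, hy, rfl⟩
    exact ⟨x + y, add_mem hx hy, by ring⟩
  neg_mem' := by
    rintro _ ⟨x, hx, rfl⟩
    exact ⟨-x, neg_mem hx, by ring⟩

variable {p}

theorem pCongr_iff {n : ℕ} {x y : ℚ} :
    PCongr p n x y ↔ x ∈ pInt p ∧ y ∈ pInt p ∧ x - y ∈ pPow p n := Iff.rfl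

theorem pPow_le {n : ℕ} {x : ℚ} (hx : x ∈ pPow p n) : x ∈ pInt p := by
  obtain ⟨z, hz, rfl⟩ := hx
  exact mul_mem (pow_mem (natCast_mem _ p) n) hz

theorem pCongr_of_sub_mem {n : ℕ} {x y : ℚ} (hy : y ∈ pInt p) (h : x - y ∈ pPow p n) :
    PCongr p n x y :=
  ⟨(by simpa using add_mem (pPow_le h) hy : x ∈ pInt p), hy, h⟩

theorem mul_mem_pPow {n : ℕ} {c x : ℚ} (hc : c ∈ pInt p) (hx : x ∈ pPow p n) :
    c * x ∈ pPow p n := by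
  obtain ⟨z, hz, rfl⟩ := hx
  exact ⟨c * z, mul_mem hc hz, by ring⟩

theorem prime_ne_zero_rat (p : ℕ) [hp : Fact p.Prime] : (p : ℚ) ≠ 0 := by
  exact_mod_cast hp.out.ne_zero

theorem p_mul_mem_pPow {n : ℕ} {x : ℚ} : (p : ℚ) * x ∈ pPow p (n + 1) ↔ x ∈ pPow p n := by
  constructor
  · rintro ⟨z, hz, h⟩
    refine ⟨z, hz, mul_left_cancel₀ (prime_ne_zero_rat p) ?_⟩
    rw [h]; ring
  · rintro ⟨z, hz, rfl⟩
    exact ⟨z, hz, by ring⟩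

theorem mem_pPow_zero {x : ℚ} : x ∈ pPow p 0 ↔ x ∈ pInt p := by
  constructor
  · exact pPow_le
  · exact fun h => ⟨x, h, by simp⟩

theorem p_mul_mem_pPow_one {x : ℚ} (hx : x ∈ pInt p) : (p : ℚ) * x ∈ pPow p 1 :=
  p_mul_mem_pPow.2 (mem_pPow_zero.2 hx)

theorem inv_natCast_mem {k : ℕ} (hk : ¬ p ∣ k) : (k : ℚ)⁻¹ ∈ pInt p := by
  change ¬ p ∣ _
  rw [Rat.inv_natCast_den]
  split_ifs with h
  · simp [h] at hk
  · exact hk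

theorem natCast_mul_mem_pPow {n k : ℕ} (hk : ¬ p ∣ k) {x : ℚ} (h : (k : ℚ) * x ∈ pPow p n) :
    x ∈ pPow p n := by
  have hk0 : (k : ℚ) ≠ 0 := by
    rintro h
    rw [Nat.cast_eq_zero] at h
    simp [h] at hk
  have := mul_mem_pPow (inv_natCast_mem hk) h
  rwa [inv_mul_cancel_left₀ hk0] at this

theorem inv_mem_pInt {t : ℚ} (ht : t ∈ pInt p) (ht1 : t ∉ pPow p 1) : t⁻¹ ∈ pInt p := by
  have h : ¬ p ∣ t.num.natAbs := by
    intro h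
    obtain ⟨c, hc⟩ := Int.natCast_dvd.2 h
    refine ht1 (natCast_mul_mem_pPow (k := t.den) ht ?_)
    rw [mul_comm, Rat.mul_den_eq_num, hc]
    push_cast
    exact p_mul_mem_pPow_one (intCast_mem _ _)
  change ¬ p ∣ _
  rwa [Rat.den_inv, if_neg (by rintro h0; simp [h0] at h)]

theorem not_dvd_factorial {k : ℕ} (hk : k < p) : ¬ p ∣ k.factorial := by
  rw [hp.out.dvd_factorial]; lia

/-- `f` takes `p`-integers to `p`-integers, with `f (x + p t) ≡ f x + p t f' x` modulo `p²`. -/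
def HasPDeriv (p : ℕ) [Fact p.Prime] (f f' : ℚ → ℚ) : Prop :=
  ∀ x ∈ pInt p, f x ∈ pInt p ∧ f' x ∈ pInt p ∧
    ∀ t ∈ pInt p, f (x + p * t) - (f x + p * t * f' x) ∈ pPow p 2

theorem HasPDeriv.congr {f f' g : ℚ → ℚ} (hf : HasPDeriv p f f') (h : ∀ x, f x = g x) :
    HasPDeriv p g f' := by
  rwa [← funext h]

theorem HasPDeriv.const {c : ℚ} (hc : c ∈ pInt p) : HasPDeriv p (fun _ => c) (fun _ => 0) :=
  fun _ _ => ⟨hc, zero_mem _, fun _ _ => by simp⟩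

theorem HasPDeriv.id : HasPDeriv p (fun x => x) (fun _ => 1) :=
  fun _ hx => ⟨hx, one_mem _, fun _ _ => by simp⟩

theorem HasPDeriv.add {f f' g g' : ℚ → ℚ} (hf : HasPDeriv p f f') (hg : HasPDeriv p g g') :
    HasPDeriv p (fun x => f x + g x) (fun x => f' x + g' x) := by
  intro x hx
  obtain ⟨h1, h2, h3⟩ := hf x hx
  obtain ⟨k1, k2, k3⟩ := hg x hx
  refine ⟨add_mem h1 k1, add_mem h2 k2, fun t ht => ?_⟩
  convert add_mem (h3 t ht) (k3 t ht) using 1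
  ring

theorem HasPDeriv.mul {f f' g g' : ℚ → ℚ} (hf : HasPDeriv p f f') (hg : HasPDeriv p g g') :
    HasPDeriv p (fun x => f x * g x) (fun x => f' x * g x + f x * g' x) := by
  intro x hx
  obtain ⟨h1, h2, h3⟩ := hf x hx
  obtain ⟨k1, k2, k3⟩ := hg x hx
  refine ⟨mul_mem h1 k1, add_mem (mul_mem h2 k1) (mul_mem h1 k2), fun t ht => ?_⟩
  have hxt : x + p * t ∈ pInt p := add_mem hx (mul_mem (natCast_mem _ p) ht)
  have e1 := mul_mem_pPow (hg _ hxt).1 (h3 t ht)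
  have e2 := mul_mem_pPow (add_mem h1 (mul_mem (mul_mem (natCast_mem _ p) ht) h2)) (k3 t ht)
  have e3 : (p : ℚ) ^ 2 * (t ^ 2 * f' x * g' x) ∈ pPow p 2 :=
    ⟨_, mul_mem (mul_mem (pow_mem ht 2) h2) k2, rfl⟩
  convert add_mem (add_mem e1 e2) e3 using 1
  ring

theorem HasPDeriv.sum {f : ℕ → ℚ → ℚ} {n : ℕ} (h : ∀ k < n, ∃ f', HasPDeriv p (f k) f') :
    ∃ g, HasPDeriv p (fun x => ∑ k ∈ Finset.range n, f k x) g := by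
  induction n with
  | zero => exact ⟨_, by simpa using HasPDeriv.const (zero_mem _)⟩
  | succ n ih =>
    obtain ⟨g, hg⟩ := ih fun k hk => h k (by lia)
    obtain ⟨f', hf'⟩ := h n (by lia)
    simp_rw [Finset.sum_range_succ]
    exact ⟨_, hg.add hf'⟩

/-- For `k < p` the denominators `1, …, k` are units. The derivative needs no formula, since
recurrences determine it modulo `p`. -/
theorem HasPDeriv.ringChoose {f f' : ℚ → ℚ} (hf : HasPDeriv p f f') {k : ℕ} (hk : k < p) :
    ∃ g, HasPDeriv p (fun x => Ring.choose (f x) k) g := by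
  induction k with
  | zero => exact ⟨_, by simpa using HasPDeriv.const (one_mem _)⟩
  | succ k ih =>
    obtain ⟨g, hg⟩ := ih (by lia)
    have hinv := inv_natCast_mem (Nat.not_dvd_of_pos_of_lt k.succ_pos hk)
    have := (HasPDeriv.const hinv).mul
      ((hf.add (HasPDeriv.const (neg_mem (natCast_mem _ k)))).mul hg)
    refine ⟨_, this.congr fun x => ?_⟩
    have h := succ_mul_ringChoose_succ (f x) k
    have h0 : ((k : ℚ) + 1) ≠ 0 := by positivity
    push_cast
    rw [inv_mul_eq_iff_eq_mul₀ h0, h]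
    ring

theorem exists_hasPDeriv_binomTwoSum {n : ℕ} (hn : n < p) :
    ∃ g, HasPDeriv p (binomTwoSum n) g :=
  HasPDeriv.sum fun k hk => by
    obtain ⟨g, hg⟩ := (HasPDeriv.id (p := p)).ringChoose (show k < p by lia)
    exact ⟨_, hg.mul (HasPDeriv.const (pow_mem (neg_mem (ofNat_mem _ 2)) k))⟩

theorem exists_hasPDeriv_binomPairSum {n : ℕ} (hn : n < p) :
    ∃ g, HasPDeriv p (binomPairSum n) g :=
  HasPDeriv.sum fun k hk => by
    obtain ⟨g, hg⟩ := (HasPDeriv.id (p := p)).ringChoose (show k < p by lia)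
    have h1 := (HasPDeriv.const (p := p) (neg_mem (one_mem _))).add
      ((HasPDeriv.const (neg_mem (one_mem _))).mul HasPDeriv.id)
    obtain ⟨g', hg'⟩ := h1.ringChoose (show k < p by lia)
    refine ⟨_, hg.mul (g' := g') ?_⟩
    convert hg' using 3
    ring

end Integral

/-! ### Binomial coefficients modulo `p²` -/

section Congruences

variable {p : ℕ} [hp : Fact p.Prime]

/-- Raising `m` by one multiplies the product by `(p + m + 1)/(m + 1) ≡ 1` modulo `p`, and the
product is itself divisible by `p`. -/
theorem fallingProd_prime_add {m : ℕ} (hm : m < p) :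
    fallingProd p (p + m) - p.factorial ∈ pPow p 2 := by
  induction m with
  | zero => simp [fallingProd_natCast_self]
  | succ m ih =>
    have h := ih (by lia)
    refine natCast_mul_mem_pPow (Nat.not_dvd_of_pos_of_lt m.succ_pos hm) ?_
    obtain ⟨q, rfl⟩ : ∃ q, p = q + 1 := ⟨p - 1, by have := hp.out.pos; lia⟩
    have h1 := fallingProd_add_one_left q ((q + 1 : ℕ) + m)
    have h2 := fallingProd_succ q ((q + 1 : ℕ) + m)
    have h3 : ((q + 1 : ℕ) : ℚ) * (q + 1).factorial ∈ pPow (q + 1) 2 :=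
      ⟨q.factorial, natCast_mem _ _, by rw [Nat.factorial_succ]; push_cast; ring⟩
    have h4 := add_mem (mul_mem_pPow (natCast_mem _ (q + 1 + m + 1)) h) h3
    convert h4 using 1
    push_cast at h1 h2 ⊢
    rw [show (q + 1 + (m + 1) : ℚ) = q + 1 + m + 1 by ring, h1, h2]
    ring

/-- Cancelling the unit `K` leaves `c(m + p) ≡ p`; this forces `p ∣ c`, so `cp` drops out modulo
`p²`. -/
theorem succ_mul_sub_mem_of_mul_sub_mem {c K' : ℚ} {m K : ℕ} (hm : 0 < m) (hmp : m < p)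
    (hK : ¬ p ∣ K) (hKK : (K : ℚ) - K' ∈ pPow p 1)
    (h : c * (m + p) * K - p * K' ∈ pPow p 2) : m * c - p ∈ pPow p 2 := by
  have h1 : c * (m + p) - p ∈ pPow p 2 := by
    refine natCast_mul_mem_pPow hK ?_
    convert sub_mem h (p_mul_mem_pPow.2 hKK) using 1
    ring
  have hp1 : (p : ℚ) ∈ pPow p 1 := ⟨1, one_mem _, by simp⟩
  have h1' := h1
  obtain ⟨z, hz, hz'⟩ := h1'
  have h2 : c ∈ pPow p 1 := by
    refine natCast_mul_mem_pPow (k := m + p) ?_ ?_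
    · rw [Nat.dvd_add_left dvd_rfl]
      exact Nat.not_dvd_of_pos_of_lt hm hmp
    · push_cast
      convert add_mem hp1 (p_mul_mem_pPow_one (mul_mem (natCast_mem _ p) hz)) using 1
      linear_combination hz'
  convert sub_mem h1 (p_mul_mem_pPow.2 h2) using 1
  ring

theorem succ_mul_ringChoose_add_prime {r n : ℕ} (hn : p = n + 1) (hr : r < n) :
    ((r + 1 : ℕ) : ℚ) * Ring.choose ((r : ℚ) + p) n - p ∈ pPow p 2 := by
  refine succ_mul_sub_mem_of_mul_sub_mem (K := n.factorial) (K' := n.factorial) r.succ_pos (by lia)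
    (not_dvd_factorial (by lia)) (by simp) ?_
  have h := fallingProd_prime_add (p := p) (m := r + 1) (by lia)
  convert h using 1
  have h1 := fallingProd_add_one_left n (r + p)
  rw [← hn] at h1
  have h2 := factorial_mul_ringChoose ((r : ℚ) + p) n
  change _ = fallingProd n _ at h2
  rw [← h2] at h1
  have h3 : (p.factorial : ℚ) = p * n.factorial := by rw [hn, Nat.factorial_succ]; push_cast; ring
  rw [h3, show ((p : ℚ) + (r + 1 : ℕ)) = r + p + 1 by push_cast; ring, h1]
  push_cast
  ring

theorem prod_prime_sub_mem (m : ℕ) :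
    ∏ j ∈ Finset.range m, ((p : ℚ) - (j + 1)) - (-1) ^ m * m.factorial ∈ pPow p 1 := by
  induction m with
  | zero => simp
  | succ m ih =>
    have h1 : ((m + 1 : ℕ) : ℚ) ∈ pInt p := natCast_mem _ _
    have h2 : ∏ j ∈ Finset.range m, ((p : ℚ) - (j + 1)) ∈ pInt p :=
      prod_mem fun j _ => sub_mem (natCast_mem _ p) (add_mem (natCast_mem _ j) (one_mem _))
    rw [Finset.prod_range_succ, Nat.factorial_succ]
    convert sub_mem (p_mul_mem_pPow_one h2) (mul_mem_pPow h1 ih) using 1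
    push_cast
    ring

/-- The upper half of `(p-1)!` is the product of `p - j` for `1 ≤ j ≤ n`, congruent to `(-1)^n n!`.
-/
theorem sq_factorial_sub_mem {n : ℕ} (hn : p = 2 * n + 1) :
    ((n.factorial ^ 2 : ℕ) : ℚ) - (-1) ^ n * (2 * n).factorial ∈ pPow p 1 := by
  have h := prod_prime_sub_mem (p := p) n
  have h1 : (∏ j ∈ Finset.range n, ((p : ℚ) - (j + 1))) * n.factorial = (2 * n).factorial := by
    have := factorial_mul_ringChoose (2 * n : ℕ) n
    have h3 := Nat.choose_mul_factorial_mul_factorial (show n ≤ 2 * n by lia)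
    rw [Ring.choose_natCast] at this
    rw [show 2 * n - n = n by lia] at h3
    rw [← h3]
    push_cast
    rw [mul_comm ((2 * n).choose n : ℚ), this]
    congr 1
    refine Finset.prod_congr rfl fun j _ => ?_
    rw [hn]
    push_cast
    ring
  have h2 := mul_mem_pPow (mul_mem (pow_mem (neg_mem (one_mem (pInt p))) n)
    (natCast_mem (pInt p) n.factorial)) h
  have h5 : ((-1 : ℚ) ^ n) * (-1) ^ n = 1 := by rw [← mul_pow]; simp
  convert neg_mem h2 using 1
  rw [← h1]
  push_cast
  linear_combination -(n.factorial : ℚ) ^ 2 * h5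

theorem succ_mul_ringChoose_mul_ringChoose {r n : ℕ} (hn : p = 2 * n + 1) (hr : r < n) :
    ((r + 1 : ℕ) : ℚ) * (Ring.choose ((r : ℚ) + p) n * Ring.choose (-2 - ((r : ℚ) + p)) n) - p
      ∈ pPow p 2 := by
  have hK : ¬ p ∣ n.factorial ^ 2 := fun h =>
    not_dvd_factorial (p := p) (k := n) (by lia) (hp.out.dvd_of_dvd_pow h)
  refine succ_mul_sub_mem_of_mul_sub_mem (K := n.factorial ^ 2)
    (K' := (-1) ^ n * (2 * n).factorial) r.succ_pos (by lia) hK (sq_factorial_sub_mem hn) ?_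
  have h := fallingProd_prime_add (p := p) (m := r + 1 + n) (by lia)
  have h1 := fallingProd_two_mul_add_one n (r + p)
  rw [← hn] at h1
  have h3 : (p.factorial : ℚ) = p * (2 * n).factorial := by
    rw [hn, Nat.factorial_succ]; push_cast; ring
  rw [h3, show ((p : ℚ) + (r + 1 + n : ℕ)) = r + p + 1 + n by push_cast; ring, h1] at h
  have h5 : ((-1 : ℚ) ^ n) * (-1) ^ n = 1 := by rw [← mul_pow]; simp
  convert mul_mem_pPow (pow_mem (neg_mem (one_mem (pInt p))) n) h using 1
  push_cast
  generalize Ring.choose ((r : ℚ) + p) n * Ring.choose (-2 - ((r : ℚ) + p)) n = c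
  linear_combination -c * (r + 1 + p) * n.factorial ^ 2 * h5

/-- A sequence of rationals that alternates modulo `p` is divisible by `p` once one term is. -/
theorem mem_pPow_of_alternating {d : ℕ → ℚ} {N m : ℕ} (hm : m ≤ N) (h0 : d m ∈ pPow p 1)
    (h : ∀ r < N, d (r + 1) + d r ∈ pPow p 1) {r : ℕ} (hr : r ≤ N) : d r ∈ pPow p 1 := by
  have key : ∀ r ≤ N, d r ∈ pPow p 1 ↔ d 0 ∈ pPow p 1 := by
    intro r hr
    induction r with
    | zero => rfl
    | succ r ih =>
      rw [← ih (by lia)]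
      constructor
      · intro h1
        simpa using sub_mem (h r (by lia)) h1
      · intro h1
        simpa using sub_mem (h r (by lia)) h1
  rw [key r hr, ← key m hm]
  exact h0

theorem natCast_pow_prime_sub_mem (m : ℕ) : ((m : ℚ) ^ p - m) ∈ pPow p 1 := by
  have h : (p : ℤ) ∣ (m : ℤ) ^ p - m := by
    rw [← ZMod.intCast_zmod_eq_zero_iff_dvd]
    push_cast
    rw [ZMod.pow_card, sub_self]
  obtain ⟨c, hc⟩ := h
  refine ⟨c, intCast_mem _ _, ?_⟩
  rw [pow_one]
  exact_mod_cast hc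

end Congruences

/-! ### Euler polynomials at `p`-integers -/

section EulerIntegral

variable {p : ℕ} [hp : Fact p.Prime]

theorem pow_sub_pow_mem_pPow {n : ℕ} {x y : ℚ} (hx : x ∈ pInt p) (hy : y ∈ pInt p)
    (h : x - y ∈ pPow p n) (k : ℕ) : x ^ k - y ^ k ∈ pPow p n := by
  induction k with
  | zero => simp
  | succ k ih =>
    convert add_mem (mul_mem_pPow hx ih) (mul_mem_pPow (pow_mem hy k) h) using 1
    ring

theorem inv_two_pow_mem (h2 : 2 < p) (k : ℕ) : 1 / (2 : ℚ) ^ k ∈ pInt p := by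
  rw [one_div, ← inv_pow]
  exact pow_mem (inv_natCast_mem (k := 2) (Nat.not_dvd_of_pos_of_lt two_pos h2)) k

theorem eulerPoly_mem_pInt (h2 : 2 < p) (k : ℕ) {x : ℚ} (hx : x ∈ pInt p) :
    eulerPoly k x ∈ pInt p :=
  mul_mem (inv_two_pow_mem h2 k) <| sum_mem fun _ _ => mul_mem (mul_mem (natCast_mem _ _)
    (pow_mem (sub_mem (mul_mem (ofNat_mem _ 2) hx) (one_mem _)) _)) (intCast_mem _ _)

theorem eulerPoly_sub_mem_pPow (h2 : 2 < p) (k : ℕ) {n : ℕ} {x y : ℚ} (hx : x ∈ pInt p)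
    (hy : y ∈ pInt p) (h : x - y ∈ pPow p n) : eulerPoly k x - eulerPoly k y ∈ pPow p n := by
  unfold eulerPoly
  rw [← mul_sub, ← Finset.sum_sub_distrib]
  refine mul_mem_pPow (inv_two_pow_mem h2 k) (sum_mem fun r _ => ?_)
  have h3 := pow_sub_pow_mem_pPow (sub_mem (mul_mem (ofNat_mem (pInt p) 2) hx) (one_mem _))
    (sub_mem (mul_mem (ofNat_mem (pInt p) 2) hy) (one_mem _))
    (by convert mul_mem_pPow (ofNat_mem (pInt p) 2) h using 1; ring) (k - r)
  convert mul_mem_pPow (mul_mem (natCast_mem _ (k.choose r)) (intCast_mem _ (eulerNum r))) h3 using 1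
  ring

theorem eulerPoly_odd_half (m : ℕ) : eulerPoly (2 * m + 1) (1 / 2) = 0 := by
  unfold eulerPoly
  rw [Finset.sum_eq_zero, mul_zero]
  intro r hr
  rw [Finset.mem_range] at hr
  rcases Nat.lt_succ_iff_lt_or_eq.1 hr with h | rfl
  · rw [show (2 * (1 / 2) - 1 : ℚ) = 0 by norm_num, zero_pow (by lia)]
    simp
  · rw [eulerNum_odd]
    simp

end EulerIntegral

/-! ### The derivatives modulo `p` -/

section Derivatives

variable {p : ℕ} [hp : Fact p.Prime] {n : ℕ} {τ σ : ℚ → ℚ}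

/-- Expand the difference equation at `r + p`: the values `(-1)^r` and `(-1)^(r+1)` cancel, and `2^p
≡ 2` by Fermat. -/
theorem binomTwoSum_deriv_add_one (hn : p = 2 * n + 1) (hτ : HasPDeriv p (binomTwoSum (2 * n)) τ)
    {r : ℕ} (hr : r < 2 * n) :
    ((r + 1 : ℕ) : ℚ) * (τ (r + 1 : ℕ) + τ r) - 2 ∈ pPow p 1 := by
  have h1 := (hτ r (natCast_mem _ _)).2.2 1 (one_mem _)
  have h2 := (hτ (r + 1 : ℕ) (natCast_mem _ _)).2.2 1 (one_mem _)
  rw [binomTwoSum_natCast (by lia), mul_one] at h1 h2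
  have h3 := binomTwoSum_add_one (2 * n) (r + p)
  have h4 := succ_mul_ringChoose_add_prime (p := p) hn hr
  have h5 : (2 : ℚ) * (-2) ^ (2 * n) = 2 ^ p := by
    rw [hn, pow_succ', Even.neg_pow (even_two_mul n)]
  have h6 : (2 : ℚ) ^ p ∈ pInt p := pow_mem (ofNat_mem _ 2) _
  have h7 := natCast_pow_prime_sub_mem (p := p) 2
  rw [h5] at h3
  rw [show ((r + 1 : ℕ) : ℚ) + p = r + p + 1 by push_cast; ring] at h2
  have h8 := sub_mem (mul_mem_pPow h6 h4)
    (mul_mem_pPow (natCast_mem (pInt p) (r + 1)) (add_mem h1 h2))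
  rw [← p_mul_mem_pPow] at h7 ⊢
  convert add_mem h7 h8 using 1
  push_cast
  linear_combination ((r : ℚ) + 1) * h3

theorem binomPairSum_deriv_add_one (hn : p = 2 * n + 1) (hσ : HasPDeriv p (binomPairSum n) σ)
    {r : ℕ} (hr : r < n) :
    ((r + 1 : ℕ) : ℚ) * (σ (r + 1 : ℕ) + σ r) - 2 ∈ pPow p 1 := by
  have h1 := (hσ r (natCast_mem _ _)).2.2 1 (one_mem _)
  have h2 := (hσ (r + 1 : ℕ) (natCast_mem _ _)).2.2 1 (one_mem _)
  rw [binomPairSum_natCast (by lia), mul_one] at h1 h2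
  have h3 := binomPairSum_add_one n (r + p)
  have h4 := succ_mul_ringChoose_mul_ringChoose (p := p) hn hr
  rw [show ((r + 1 : ℕ) : ℚ) + p = r + p + 1 by push_cast; ring] at h2
  have h8 := sub_mem (mul_mem_pPow (ofNat_mem (pInt p) 2) h4)
    (mul_mem_pPow (natCast_mem (pInt p) (r + 1)) (add_mem h1 h2))
  rw [← p_mul_mem_pPow]
  convert h8 using 1
  push_cast
  linear_combination ((r : ℚ) + 1) * h3

/-- The values at `p = 0 + p` and `-1 = 2n - p` are exactly equal; expand them about `0` and `2n`.
-/
theorem binomTwoSum_deriv_zero_add (hn : p = 2 * n + 1)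
    (hτ : HasPDeriv p (binomTwoSum (2 * n)) τ) : τ 0 + τ (2 * n : ℕ) ∈ pPow p 1 := by
  have h1 := (hτ 0 (zero_mem _)).2.2 1 (one_mem _)
  have h2 := (hτ (2 * n : ℕ) (natCast_mem _ _)).2.2 (-1) (neg_mem (one_mem _))
  have h3 := binomTwoSum_natCast_add_one (2 * n)
  have h4 := binomTwoSum_neg_one (2 * n)
  have hp' : (p : ℚ) = (2 * n : ℕ) + 1 := by exact_mod_cast hn
  rw [show (0 : ℚ) + p * 1 = (2 * n : ℕ) + 1 by rw [hp']; ring, h3, binomTwoSum_zero,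
    Even.neg_pow (even_two_mul n), Even.neg_pow (even_two_mul n)] at h1
  rw [show ((2 * n : ℕ) : ℚ) + p * (-1) = -1 by rw [hp']; ring, h4,
    binomTwoSum_natCast le_rfl, Even.neg_pow (even_two_mul n)] at h2
  rw [← p_mul_mem_pPow]
  convert sub_mem h2 h1 using 1
  simp only [one_pow]
  ring

theorem binomTwoSum_deriv_antisymm (hn : p = 2 * n + 1)
    (hτ : HasPDeriv p (binomTwoSum (2 * n)) τ) {r : ℕ} (hr : r ≤ 2 * n) :
    τ r + τ (2 * n - r : ℕ) ∈ pPow p 1 := by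
  refine mem_pPow_of_alternating (p := p) (d := fun r : ℕ => τ r + τ (2 * n - r : ℕ))
    (N := 2 * n) (m := 0) (zero_le) ?_ ?_ hr
  · simpa using binomTwoSum_deriv_zero_add hn hτ
  · intro r hr
    obtain ⟨s, hs⟩ : ∃ s, 2 * n = r + s + 1 := ⟨2 * n - r - 1, by lia⟩
    have h1 := binomTwoSum_deriv_add_one hn hτ hr
    have h2 := binomTwoSum_deriv_add_one hn hτ (r := s) (by lia)
    rw [show 2 * n - (r + 1) = s by lia, show 2 * n - r = s + 1 by lia]
    refine natCast_mul_mem_pPow (k := r + 1) (Nat.not_dvd_of_pos_of_lt r.succ_pos (by lia)) ?_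
    have h3 := p_mul_mem_pPow_one (add_mem (hτ (s + 1 : ℕ) (natCast_mem _ _)).2.1
      (hτ s (natCast_mem _ _)).2.1)
    -- Since `(r + 1) + (s + 1) = p`, the two recurrences have opposite right-hand sides modulo `p`.
    convert add_mem (sub_mem h1 h2) h3 using 1
    have hp' : (p : ℚ) = (r + 1 : ℕ) + (s + 1 : ℕ) := by
      rw [hn, hs]; push_cast; ring
    rw [hp']
    ring

theorem binomTwoSum_deriv_half (hn : p = 2 * n + 1)
    (hτ : HasPDeriv p (binomTwoSum (2 * n)) τ) (h2 : 2 < p) : τ n ∈ pPow p 1 := by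
  have h := binomTwoSum_deriv_antisymm hn hτ (r := n) (by lia)
  rw [show 2 * n - n = n by lia] at h
  refine natCast_mul_mem_pPow (k := 2) (Nat.not_dvd_of_pos_of_lt two_pos h2) ?_
  convert h using 1
  push_cast
  ring

/-- The reflection `x ↦ -1 - x` sends `n` to `n - p`, so the first-order term vanishes modulo `p²`.
-/
theorem binomPairSum_deriv_half (hn : p = 2 * n + 1) (hσ : HasPDeriv p (binomPairSum n) σ) :
    σ n ∈ pPow p 1 := by
  have h := (hσ n (natCast_mem _ _)).2.2 (-1) (neg_mem (one_mem _))
  have hp' : (p : ℚ) = 2 * n + 1 := by exact_mod_cast hn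
  rw [show (n : ℚ) + p * (-1) = -1 - n by rw [hp']; ring, binomPairSum_symm] at h
  rw [← p_mul_mem_pPow]
  convert h using 1
  ring

theorem binomPairSum_deriv_sub_mem (hn : p = 2 * n + 1) (h2 : 2 < p)
    (hτ : HasPDeriv p (binomTwoSum (2 * n)) τ) (hσ : HasPDeriv p (binomPairSum n) σ)
    {r : ℕ} (hr : r ≤ n) : σ r - τ r ∈ pPow p 1 := by
  refine mem_pPow_of_alternating (p := p) (d := fun r : ℕ => σ r - τ r)
    (N := n) (m := n) le_rfl ?_ ?_ hr
  · exact sub_mem (binomPairSum_deriv_half hn hσ) (binomTwoSum_deriv_half hn hτ h2)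
  · intro r hr
    refine natCast_mul_mem_pPow (k := r + 1) (Nat.not_dvd_of_pos_of_lt r.succ_pos (by lia)) ?_
    convert sub_mem (binomPairSum_deriv_add_one hn hσ hr)
      (binomTwoSum_deriv_add_one hn hτ (r := r) (by lia)) using 1
    ring

theorem binomTwoSum_deriv_add_eulerPoly (hn : p = 2 * n + 1) (h2 : 2 < p)
    (hτ : HasPDeriv p (binomTwoSum (2 * n)) τ) {r : ℕ} (hr : r ≤ 2 * n) :
    τ r + eulerPoly (p - 2) (-r) ∈ pPow p 1 := by
  obtain ⟨m, rfl⟩ : ∃ m, n = m + 1 := ⟨n - 1, by lia⟩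
  rw [show p - 2 = 2 * m + 1 by lia]
  refine mem_pPow_of_alternating (p := p) (d := fun r : ℕ => τ r + eulerPoly (2 * m + 1) (-r))
    (N := 2 * (m + 1)) (m := m + 1) (by lia) ?_ ?_ hr
  · refine add_mem (binomTwoSum_deriv_half hn hτ h2) ?_
    have hhalf : (1 / 2 : ℚ) ∈ pInt p := by simpa using inv_two_pow_mem h2 1
    have h := eulerPoly_sub_mem_pPow (n := 1) h2 (2 * m + 1)
      (neg_mem (natCast_mem (pInt p) (m + 1))) hhalf ?_
    · rwa [eulerPoly_odd_half, sub_zero] at h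
    -- `-n - 1/2 = -p/2`, so `-n` is congruent to the zero `1/2` of the odd-index Euler polynomial.
    · convert neg_mem (p_mul_mem_pPow_one hhalf) using 1
      rw [hn]
      push_cast
      ring
  · intro r hr
    have h1 := binomTwoSum_deriv_add_one hn hτ hr
    have h3 := eulerPoly_add_one (2 * m + 1) (-(r + 1 : ℕ))
    have h4 := natCast_pow_prime_sub_mem (p := p) (r + 1)
    have hndvd : ¬ p ∣ r + 1 := Nat.not_dvd_of_pos_of_lt r.succ_pos (by lia)
    -- Fermat turns `2(r + 1)^(p-2)` into `2/(r + 1)`, matching the recurrence of `τ`.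
    have h5 : ((r + 1 : ℕ) : ℚ) ^ (2 * m + 2) - 1 ∈ pPow p 1 := by
      refine natCast_mul_mem_pPow hndvd ?_
      convert h4 using 1
      rw [hn]
      ring
    refine natCast_mul_mem_pPow hndvd ?_
    convert sub_mem h1 (mul_mem_pPow (ofNat_mem (pInt p) 2) h5) using 1
    rw [Odd.neg_pow (odd_two_mul_add_one m),
      show -((r + 1 : ℕ) : ℚ) + 1 = -r by push_cast; ring] at h3
    linear_combination ((r + 1 : ℕ) : ℚ) * h3

theorem binomPairSum_sub_mem_of_gt (hn : p = 2 * n + 1) (h2 : 2 < p)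
    (hτ : HasPDeriv p (binomTwoSum (2 * n)) τ) {r : ℕ} (hr : n < r) (hr' : r ≤ 2 * n)
    {t : ℚ} (ht : t ∈ pInt p) :
    binomPairSum n (r + p * t) - ((-1) ^ r + p * (1 + t) * τ r) ∈ pPow p 2 := by
  obtain ⟨σ, hσ⟩ := exists_hasPDeriv_binomPairSum (p := p) (n := n) (by lia)
  obtain ⟨s, hs⟩ : ∃ s, 2 * n = r + s := ⟨2 * n - r, by lia⟩
  -- Reflection: `-1 - (r + pt) = s + p(-1 - t)` with `s = p - 1 - r < n`.
  have ht' : -1 - t ∈ pInt p := sub_mem (neg_mem (one_mem _)) ht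
  have h1 := (hσ s (natCast_mem _ _)).2.2 _ ht'
  have h3 := binomPairSum_deriv_sub_mem hn h2 hτ hσ (r := s) (by lia)
  have h4 := binomTwoSum_deriv_antisymm hn hτ hr'
  have hp' : (p : ℚ) = r + s + 1 := by rw [hn, hs]; push_cast; ring
  have hpow : (-1 : ℚ) ^ s = (-1) ^ r := by
    rw [← neg_one_pow_congr (R := ℚ)]
    rw [Nat.even_iff, Nat.even_iff]
    lia
  rw [show 2 * n - r = s by lia] at h4
  rw [binomPairSum_natCast (by lia), hpow, show (s : ℚ) + p * (-1 - t) = -1 - (r + p * t) by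
    linear_combination -hp', binomPairSum_symm] at h1
  have h5 := p_mul_mem_pPow.2 (mul_mem_pPow ht' (add_mem h3 h4))
  convert add_mem h1 h5 using 1
  ring

end Derivatives

theorem theorem3p1 (p : ℕ) (hp : p.Prime) (hp3 : 3 < p) (a : ℚ) (ha : IsPIntegral p a)
    (ha0 : ¬ PCongr p 1 a 0) (t : ℚ) (ht : t = (a - leastResidue p a) / p) :
    (leastResidue p a ≤ (p - 1) / 2 →
      PCongr p 2
        (∑ k ∈ Finset.range ((p - 1) / 2 + 1), Ring.choose a k * Ring.choose (-1 - a) k)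
        (∑ k ∈ Finset.range p, Ring.choose a k * (-2) ^ k)) ∧
    ((p - 1) / 2 < leastResidue p a → ¬ PCongr p 1 t 0 →
      PCongr p 2
        (∑ k ∈ Finset.range ((p - 1) / 2 + 1), Ring.choose a k * Ring.choose (-1 - a) k)
        ((1 + 1 / t) * (∑ k ∈ Finset.range p, Ring.choose a k * (-2) ^ k)
          - (-1) ^ leastResidue p a * (1 / t))) ∧
    ((p - 1) / 2 < leastResidue p a → PCongr p 1 t 0 →
      PCongr p 2
        (∑ k ∈ Finset.range ((p - 1) / 2 + 1), Ring.choose a k * Ring.choose (-1 - a) k)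
        ((-1) ^ leastResidue p a - p * eulerPoly (p - 2) (-a))) := by
  have : Fact p.Prime := ⟨hp⟩
  have h2 : 2 < p := by lia
  obtain ⟨n, hn⟩ : ∃ n, p = 2 * n + 1 := hp.odd_of_ne_two (by lia)
  have hr : leastResidue p a ≤ 2 * n := by have := leastResidue_lt p hp a; lia
  obtain ⟨-, -, t', ht', h⟩ := pCongr_leastResidue p hp a ha
  have hp0 := prime_ne_zero_rat p
  obtain rfl : t' = t := by rw [ht, h]; field_simp
  have ht1 : t' ∈ pInt p := ht'
  have hat : a = leastResidue p a + p * t' := by linear_combination h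
  have ha1 : a ∈ pInt p := ha
  rw [show (p - 1) / 2 = n by lia]
  change (_ → PCongr p 2 (binomPairSum n a) _) ∧ (_ → _ → PCongr p 2 (binomPairSum n a) _) ∧
    (_ → _ → PCongr p 2 (binomPairSum n a) _)
  have hT : ∑ k ∈ Finset.range p, Ring.choose a k * (-2) ^ k = binomTwoSum (2 * n) a := by
    rw [binomTwoSum, hn]
  rw [hT]
  generalize leastResidue p a = r at *
  obtain ⟨τ, hτ⟩ := exists_hasPDeriv_binomTwoSum (p := p) (n := 2 * n) (by lia)
  have hTa := (hτ r (natCast_mem _ _)).2.2 t' ht1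
  have hτr := (hτ r (natCast_mem _ _)).2.1
  rw [← hat, binomTwoSum_natCast hr] at hTa
  have hTint := (hτ a ha1).1
  have hsign : (-1 : ℚ) ^ r ∈ pInt p := pow_mem (neg_mem (one_mem _)) r
  refine ⟨fun hrn => ?_, fun hrn htp => ?_, fun hrn htp => ?_⟩
  · obtain ⟨σ, hσ⟩ := exists_hasPDeriv_binomPairSum (p := p) (n := n) (by lia)
    have hS := (hσ r (natCast_mem _ _)).2.2 t' ht1
    rw [← hat, binomPairSum_natCast hrn] at hS
    refine pCongr_of_sub_mem hTint ?_
    have h5 := p_mul_mem_pPow.2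
      (mul_mem_pPow ht1 (binomPairSum_deriv_sub_mem hn h2 hτ hσ hrn))
    convert add_mem (sub_mem hS hTa) h5 using 1
    ring
  · have htn : t' ∉ pPow p 1 := fun h =>
      htp (pCongr_of_sub_mem (zero_mem _) (by simpa using h))
    have ht0 : t' ≠ 0 := by rintro rfl; exact htn (zero_mem _)
    have hinv : 1 / t' ∈ pInt p := by simpa using inv_mem_pInt ht1 htn
    have hfac : 1 + 1 / t' ∈ pInt p := add_mem (one_mem _) hinv
    have hS := binomPairSum_sub_mem_of_gt hn h2 hτ hrn hr ht1
    rw [← hat] at hS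
    refine pCongr_of_sub_mem (sub_mem (mul_mem hfac hTint) (mul_mem hsign hinv)) ?_
    -- `(1 + 1/t)((-1)^r + ptτ(r)) - (-1)^r/t = (-1)^r + p(1 + t)τ(r)`.
    convert sub_mem hS (mul_mem_pPow hfac hTa) using 1
    field_simp
    ring
  · have htp' : t' ∈ pPow p 1 := by simpa using (pCongr_iff.1 htp).2.2
    have hS := binomPairSum_sub_mem_of_gt hn h2 hτ hrn hr ht1
    rw [← hat] at hS
    have hE := eulerPoly_mem_pInt h2 (p - 2) (neg_mem ha1)
    have hEa := eulerPoly_sub_mem_pPow (n := 1) h2 (p - 2) (neg_mem ha1)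
      (neg_mem (natCast_mem (pInt p) r)) (by
        convert neg_mem (p_mul_mem_pPow_one ht1) using 1
        linear_combination -hat)
    have hEr := binomTwoSum_deriv_add_eulerPoly hn h2 hτ hr
    refine pCongr_of_sub_mem (sub_mem hsign (mul_mem (natCast_mem _ p) hE)) ?_
    -- As `p ∣ t`, the term `ptτ(r)` vanishes modulo `p²`, leaving `pτ(r) ≡ -pE_{p-2}(-a)`.
    have h6 := p_mul_mem_pPow.2 (add_mem (add_mem hEa hEr) (mul_mem_pPow hτr htp'))
    convert add_mem hS h6 using 1
    ring
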